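/- Let $n\ge 0$, $[n]=\{1,\dots,n\}$, and let $f\colon 2^{[n]}\to\mathbb{Z}$ satisfy $f(\emptyset)=0$ and $f(I)+f(J)\ge f(I\cup J)+f(I\cap J)$ for all $I,J\subseteq[n]$. Let $$P=\Big\{a\in\mathbb{Z}^n : \sum_{i\in I}a_i\le f(I)\text{ for all } I\subseteq[n],\ \sum_{i\in[n]}a_i=f([n])\Big\}$$ be the polymatroid on $[n]$ with rank function $f$ (a finite set). For $a\in P$ let $\mathrm{Int}(a)$ be the set of $i\in[n]$ such that $a-e_i+e_j\notin P$ for all $j<i$, and $\mathrm{Ext}(a)$ the set of $i\in[n]$ such that $a+e_i-e_j\notin P$ for all $j<i$, where $e_1,\dots,e_n$ is the standard basis. Let $$\mathscr{T}_P(x,y)=\sum_{a\in P}x^{|\mathrm{Int}(a)\setminus\mathrm{Ext}(a)|}\,y^{|\mathrm{Ext}(a)\setminus\mathrm{Int}(a)|}\,(x+y-1)^{|\mathrm{Int}(a)\cap\mathrm{Ext}(a)|}$$ be the polymatroid Tutte polynomial. Write $\binom{m}{2}=m(m-1)/2$ for every integer $m$ (possibly negative), and write $x^ky^l[\mathscr{T}_P]$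 for the coefficient of $x^ky^l$ in $\mathscr{T}_P(x,y)$, which is $0$ if $k<0$ or $l<0$. Then (1) the coefficient of $x^{n-2}y^0$ is $$x^{n-2}y^0[\mathscr{T}_P]=\binom{\sum_{i\in[n]}f(\{i\})-f([n])+1-n}{2}-\sum_{\{i,j\}\subseteq[n],\,i\ne j}\binom{f(\{i\})+f(\{j\})-f(\{i,j\})}{2};$$ (2) the coefficient of $x^0y^{n-2}$ is $$x^0y^{n-2}[\mathscr{T}_P]=\binom{\sum_{i\in[n]}f([n]\setminus\{i\})-(n-1)f([n])+1-n}{2}-\sum_{\{i,j\}\subseteq[n],\,i\ne j}\binom{f([n]\setminus\{i\})+f([n]\setminus\{j\})-f([n]\setminus\{i,j\})-f([n])}{2}.$$ The sums over $\{i,j\}$ run over unordered pairs of distinct elements. -/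

import Mathlib

namespace Polymatroid

/-- `P ⊆ ℤⁿ` is the (integer) polymatroid with rank function `f : 2^[n] → ℤ`: the function `f`
vanishes on the empty set and is submodular, and `P` is the set of integer vectors `a` with
`∑_{i ∈ I} a_i ≤ f I` for all `I`, and `∑_{i ∈ [n]} a_i = f [n]`. -/
structure IsPolymatroid {n : ℕ} (P : Set (Fin n → ℤ)) (f : Finset (Fin n) → ℤ) : Prop where
  rank_empty : f ∅ = 0
  submodular : ∀ I J : Finset (Fin n), f (I ∪ J) + f (I ∩ J) ≤ f I + f J
  mem_iff : ∀ a : Fin n → ℤ,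
    a ∈ P ↔ (∀ I : Finset (Fin n), ∑ i ∈ I, a i ≤ f I) ∧ ∑ i, a i = f Finset.univ

/-- The index `i` is internally active for `a`: `a - e_i + e_j ∉ P` for all `j < i`. -/
def InternallyActive {n : ℕ} (P : Set (Fin n → ℤ)) (a : Fin n → ℤ) (i : Fin n) : Prop :=
  ∀ j : Fin n, j < i → a - Pi.single i 1 + Pi.single j 1 ∉ P

/-- The index `i` is externally active for `a`: `a + e_i - e_j ∉ P` for all `j < i`. -/
def ExternallyActive {n : ℕ} (P : Set (Fin n → ℤ)) (a : Fin n → ℤ) (i : Fin n) : Prop :=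
  ∀ j : Fin n, j < i → a + Pi.single i 1 - Pi.single j 1 ∉ P

open Classical in
/-- The set `Int_P(a)` of internally active indices. -/
noncomputable def intSet {n : ℕ} (P : Set (Fin n → ℤ)) (a : Fin n → ℤ) : Finset (Fin n) :=
  Finset.univ.filter (InternallyActive P a)

open Classical in
/-- The set `Ext_P(a)` of externally active indices. -/
noncomputable def extSet {n : ℕ} (P : Set (Fin n → ℤ)) (a : Fin n → ℤ) : Finset (Fin n) :=
  Finset.univ.filter (ExternallyActive P a)

/-- The polymatroid Tutte polynomial
`∑_{a ∈ P} x^{|Int \ Ext|} y^{|Ext \ Int|} (x + y - 1)^{|Int ∩ Ext|}`, with `x = X 0`, `y = X 1`.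
The sum is finite for every polymatroid `P`, see `IsPolymatroid.finite`. -/
noncomputable def tutte {n : ℕ} (P : Set (Fin n → ℤ)) : MvPolynomial (Fin 2) ℤ :=
  ∑ᶠ a ∈ P,
    MvPolynomial.X 0 ^ (intSet P a \ extSet P a).card *
      MvPolynomial.X 1 ^ (extSet P a \ intSet P a).card *
      (MvPolynomial.X 0 + MvPolynomial.X 1 - 1) ^ (intSet P a ∩ extSet P a).card

/-- The coefficient of `x^k y^l` in a polynomial in `x = X 0`, `y = X 1`, for integer exponents
`k`, `l`; it is zero when an exponent is negative. -/
noncomputable def coeffXY (p : MvPolynomial (Fin 2) ℤ) (k l : ℤ) : ℤ :=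
  if 0 ≤ k ∧ 0 ≤ l then
    p.coeff (Finsupp.single 0 k.toNat + Finsupp.single 1 l.toNat)
  else 0

/-- A polymatroid is a finite set. -/
theorem IsPolymatroid.finite {n : ℕ} {P : Set (Fin n → ℤ)} {f : Finset (Fin n) → ℤ}
    (h : IsPolymatroid P f) : P.Finite := by
  refine (Set.finite_Icc (fun i : Fin n => f Finset.univ - f {i}ᶜ)
    (fun i : Fin n => f {i})).subset ?_
  intro a ha
  obtain ⟨hle, heq⟩ := (h.mem_iff a).1 ha
  refine ⟨fun i => ?_, fun i => by simpa using hle {i}⟩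
  have h1 := hle {i}ᶜ
  have h2 := Finset.sum_add_sum_compl {i} a
  simp only [Finset.sum_singleton] at h2
  show f Finset.univ - f {i}ᶜ ≤ a i
  linarith

end Polymatroid

/-! Induct on `n` by cutting `P` into slices of constant last coordinate `t`. The last index is
compared with every other one, so it is internally active exactly when `t` is minimal and externally
active exactly when `t` is maximal; activity of the other indices only sees the slice. Hence
`tutte_eq_sum_slice`. For pure powers of `x`, the bottom slice shifts the exponent, the top slice
carries a factor `y` and drops out, and the slices strictly between add up.

The coefficients of `x ^ n`, `x ^ (n - 1)`, `x ^ (n - 2)` thus come from successive summation over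
`t`: constant, linear, quadratic. Slicing truncates the rank of `{i}` to `min (f {i}) (f {i, last} -
t)`; summing these truncations over `t` yields the binomials of pairs.

Part (2) is part (1) for `-P`, where internal and external activity trade places. -/

namespace Polymatroid

open MvPolynomial

/-! ### Duality `P ↦ -P` -/

section Duality

variable {n : ℕ} {P : Set (Fin n → ℤ)} {f : Finset (Fin n) → ℤ}

/-- The rank function of the dual polymatroid `-P`. -/
def dualRank (f : Finset (Fin n) → ℤ) (I : Finset (Fin n)) : ℤ := f Iᶜ - f Finset.univ

theorem IsPolymatroid.neg (h : IsPolymatroid P f) : IsPolymatroid (-P) (dualRank f) where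
  rank_empty := by simp [dualRank]
  submodular I J := by
    have := h.submodular Iᶜ Jᶜ
    simp only [dualRank, Finset.compl_union, Finset.compl_inter]
    linarith
  mem_iff a := by
    rw [Set.mem_neg, h.mem_iff]
    simp only [Pi.neg_apply, Finset.sum_neg_distrib, dualRank, Finset.compl_univ, h.rank_empty]
    refine ⟨fun ⟨h1, h2⟩ => ⟨fun I => ?_, by linarith⟩, fun ⟨h1, h2⟩ => ⟨fun I => ?_, by linarith⟩⟩
    · have := h1 Iᶜ
      have := Finset.sum_add_sum_compl I a
      linarith
    · have := h1 Iᶜ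
      have := Finset.sum_add_sum_compl I a
      rw [compl_compl] at *
      linarith

theorem internallyActive_neg (P : Set (Fin n → ℤ)) (a : Fin n → ℤ) (i : Fin n) :
    InternallyActive (-P) (-a) i ↔ ExternallyActive P a i := by
  refine forall₂_congr fun j _ => ?_
  rw [Set.mem_neg, show -(-a - Pi.single i 1 + Pi.single j 1) =
    a + Pi.single i 1 - Pi.single j (1 : ℤ) by abel]

theorem externallyActive_neg (P : Set (Fin n → ℤ)) (a : Fin n → ℤ) (i : Fin n) :
    ExternallyActive (-P) (-a) i ↔ InternallyActive P a i := by
  rw [← internallyActive_neg, neg_neg, neg_neg]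

theorem intSet_neg (P : Set (Fin n → ℤ)) (a : Fin n → ℤ) : intSet (-P) (-a) = extSet P a := by
  ext i
  simp [intSet, extSet, internallyActive_neg]

theorem extSet_neg (P : Set (Fin n → ℤ)) (a : Fin n → ℤ) : extSet (-P) (-a) = intSet P a := by
  ext i
  simp [intSet, extSet, externallyActive_neg]

theorem IsPolymatroid.tutte_neg (h : IsPolymatroid P f) :
    tutte (-P) = rename (Equiv.swap 0 1) (tutte P) := by
  unfold tutte
  rw [← Set.image_neg_eq_neg, finsum_mem_image neg_injective.injOn,
    finsum_mem_eq_finite_toFinset_sum _ h.finite, finsum_mem_eq_finite_toFinset_sum _ h.finite,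
    map_sum]
  refine Finset.sum_congr rfl fun a _ => ?_
  rw [Set.image_neg_eq_neg, intSet_neg, extSet_neg, Finset.inter_comm]
  simp only [map_mul, map_pow, map_add, map_sub, map_one, rename_X, Equiv.swap_apply_left,
    Equiv.swap_apply_right]
  ring

theorem coeffXY_rename_swap (p : MvPolynomial (Fin 2) ℤ) (k l : ℤ) :
    coeffXY (rename (Equiv.swap 0 1) p) k l = coeffXY p l k := by
  simp only [coeffXY, and_comm (a := 0 ≤ k)]
  split_ifs
  · rw [← coeff_rename_mapDomain (Equiv.swap 0 1) (Equiv.injective _) p, Finsupp.mapDomain_add,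
      Finsupp.mapDomain_single, Finsupp.mapDomain_single, add_comm]
    simp
  · rfl

end Duality

/-! ### Activity of the last index, and slices -/

section LastIndex

variable {n : ℕ} {P : Set (Fin (n + 1) → ℤ)} {f : Finset (Fin (n + 1)) → ℤ}

theorem IsPolymatroid.tight_union {n : ℕ} {P : Set (Fin n → ℤ)} {f : Finset (Fin n) → ℤ}
    (h : IsPolymatroid P f) {a : Fin n → ℤ} (ha : a ∈ P) {I J : Finset (Fin n)}
    (hI : ∑ i ∈ I, a i = f I) (hJ : ∑ i ∈ J, a i = f J) :
    ∑ i ∈ I ∪ J, a i = f (I ∪ J) := by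
  have h1 := ((h.mem_iff a).1 ha).1
  have h2 := Finset.sum_union_inter (s₁ := I) (s₂ := J) (f := a)
  linarith [h1 (I ∪ J), h1 (I ∩ J), h.submodular I J]

/-- A failed exchange is witnessed by a tight set. -/
theorem IsPolymatroid.exists_tight {n : ℕ} {P : Set (Fin n → ℤ)} {f : Finset (Fin n) → ℤ}
    (h : IsPolymatroid P f) {a : Fin n → ℤ} (ha : a ∈ P) {i j : Fin n}
    (hij : a - Pi.single i 1 + Pi.single j 1 ∉ P) :
    ∃ I : Finset (Fin n), j ∈ I ∧ i ∉ I ∧ ∑ k ∈ I, a k = f I := by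
  have h1 := (h.mem_iff a).1 ha
  by_contra! hc
  refine hij ((h.mem_iff _).2 ⟨fun I => ?_, ?_⟩)
  · have hI := h1.1 I
    have hcI := hc I
    simp only [Pi.add_apply, Pi.sub_apply, Finset.sum_add_distrib, Finset.sum_sub_distrib,
      Finset.sum_pi_single']
    split_ifs with hi hj hj <;> try linarith
    have := lt_of_le_of_ne hI (hcI hj hi)
    linarith
  · simp [Finset.sum_add_distrib, Finset.sum_sub_distrib, h1.2]

/-- The least value of the last coordinate. -/
def lastMin (f : Finset (Fin (n + 1)) → ℤ) : ℤ := f Finset.univ - f {Fin.last n}ᶜ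

theorem IsPolymatroid.lastMin_le (h : IsPolymatroid P f) {a : Fin (n + 1) → ℤ} (ha : a ∈ P) :
    lastMin f ≤ a (Fin.last n) := by
  have h1 := (h.mem_iff a).1 ha
  have h2 := Finset.sum_add_sum_compl {Fin.last n} a
  have := h1.1 {Fin.last n}ᶜ
  simp only [Finset.sum_singleton] at h2
  unfold lastMin
  linarith

theorem IsPolymatroid.le_lastMax (h : IsPolymatroid P f) {a : Fin (n + 1) → ℤ} (ha : a ∈ P) :
    a (Fin.last n) ≤ f {Fin.last n} := by
  simpa using ((h.mem_iff a).1 ha).1 {Fin.last n}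

theorem IsPolymatroid.lastMin_le_lastMax (h : IsPolymatroid P f) :
    lastMin f ≤ f {Fin.last n} := by
  have := h.submodular {Fin.last n} {Fin.last n}ᶜ
  rw [Finset.union_compl, Finset.inter_compl, h.rank_empty] at this
  unfold lastMin
  linarith

/-- Each failed exchange with `j` gives a tight set containing `j` but not the last index. Tight
sets are closed under union, so the complement of the last index is tight, which forces the minimum.
-/
theorem IsPolymatroid.internallyActive_last_iff (h : IsPolymatroid P f) {a : Fin (n + 1) → ℤ}
    (ha : a ∈ P) : InternallyActive P a (Fin.last n) ↔ a (Fin.last n) = lastMin f := by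
  constructor
  · intro hact
    choose! T hT using fun j (hj : j < Fin.last n) => h.exists_tight ha (hact j hj)
    have key : ∀ s : Finset (Fin (n + 1)), (∀ j ∈ s, j < Fin.last n) →
        ∑ k ∈ s.biUnion T, a k = f (s.biUnion T) := by
      intro s
      induction s using Finset.induction_on with
      | empty => simp [h.rank_empty]
      | insert j s _ ih =>
        intro hs
        rw [Finset.biUnion_insert]
        exact h.tight_union ha (hT j (hs j (by simp))).2.2
          (ih fun k hk => hs k (Finset.mem_insert_of_mem hk))
    have hlt : ∀ j ∈ ({Fin.last n}ᶜ : Finset (Fin (n + 1))), j < Fin.last n := fun j hj =>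
      Fin.lt_last_iff_ne_last.2 (by simpa using hj)
    have hU : ({Fin.last n}ᶜ : Finset (Fin (n + 1))).biUnion T = {Fin.last n}ᶜ := by
      ext k
      simp only [Finset.mem_biUnion]
      constructor
      · rintro ⟨j, hj, hk⟩
        have := (hT j (hlt j hj)).2.1
        simp only [Finset.mem_compl, Finset.mem_singleton]
        rintro rfl
        exact this hk
      · exact fun hk => ⟨k, hk, (hT k (hlt k hk)).1⟩
    have h3 := key _ hlt
    rw [hU] at h3
    have h2 := Finset.sum_add_sum_compl {Fin.last n} a
    simp only [Finset.sum_singleton] at h2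
    have := ((h.mem_iff a).1 ha).2
    unfold lastMin
    linarith
  -- The exchange would lower the last coordinate below its minimum.
  · intro heq j hj hmem
    have := h.lastMin_le hmem
    simp [hj.ne'] at this
    linarith

theorem IsPolymatroid.externallyActive_last_iff (h : IsPolymatroid P f) {a : Fin (n + 1) → ℤ}
    (ha : a ∈ P) : ExternallyActive P a (Fin.last n) ↔ a (Fin.last n) = f {Fin.last n} := by
  rw [← internallyActive_neg, h.neg.internallyActive_last_iff (by simpa using ha)]
  simp only [Pi.neg_apply, lastMin, dualRank, Finset.compl_univ, h.rank_empty, compl_compl]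
  constructor <;> intro _ <;> linarith

/-- The slice of `P` at height `t` in the last coordinate. -/
def slice (P : Set (Fin (n + 1) → ℤ)) (t : ℤ) : Set (Fin n → ℤ) :=
  {b | (Fin.snoc b t : Fin (n + 1) → ℤ) ∈ P}

/-- The rank function of a slice. -/
def sliceRank (f : Finset (Fin (n + 1)) → ℤ) (t : ℤ) (I : Finset (Fin n)) : ℤ :=
  min (f (I.map Fin.castSuccEmb)) (f (insert (Fin.last n) (I.map Fin.castSuccEmb)) - t)

theorem map_castSucc_univ :
    (Finset.univ : Finset (Fin n)).map Fin.castSuccEmb = {Fin.last n}ᶜ := by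
  ext i
  induction i using Fin.lastCases <;> simp [Fin.castSucc_ne_last]

theorem last_notMem_map (I : Finset (Fin n)) : Fin.last n ∉ I.map Fin.castSuccEmb := by
  simp [Fin.castSucc_ne_last]

theorem insert_last_map_univ :
    insert (Fin.last n) ((Finset.univ : Finset (Fin n)).map Fin.castSuccEmb) = Finset.univ := by
  rw [map_castSucc_univ]
  ext i
  simp

theorem exists_eq_map_castSucc (I : Finset (Fin (n + 1))) : ∃ J : Finset (Fin n),
    I = J.map Fin.castSuccEmb ∨ I = insert (Fin.last n) (J.map Fin.castSuccEmb) := by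
  refine ⟨Finset.univ.filter fun j => j.castSucc ∈ I, ?_⟩
  by_cases hl : Fin.last n ∈ I
  · right
    ext i
    induction i using Fin.lastCases <;> simp [hl, Fin.castSucc_ne_last]
  · left
    ext i
    induction i using Fin.lastCases <;> simp [hl, Fin.castSucc_ne_last]

theorem sum_map_snoc (b : Fin n → ℤ) (t : ℤ) (I : Finset (Fin n)) :
    ∑ i ∈ I.map Fin.castSuccEmb, (Fin.snoc b t : Fin (n + 1) → ℤ) i = ∑ i ∈ I, b i := by
  simp

theorem sum_insert_snoc (b : Fin n → ℤ) (t : ℤ) (I : Finset (Fin n)) :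
    ∑ i ∈ insert (Fin.last n) (I.map Fin.castSuccEmb), (Fin.snoc b t : Fin (n + 1) → ℤ) i =
      t + ∑ i ∈ I, b i := by
  rw [Finset.sum_insert (last_notMem_map I), sum_map_snoc, Fin.snoc_last]

/-- The upper bound on `t` gives rank zero to the empty set; the lower bound makes the second term
the minimum at the full set. -/
theorem IsPolymatroid.slice (h : IsPolymatroid P f) {t : ℤ} (h1 : lastMin f ≤ t)
    (h2 : t ≤ f {Fin.last n}) : IsPolymatroid (slice P t) (sliceRank f t) where
  rank_empty := by simpa [sliceRank, h.rank_empty] using h2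
  submodular I J := by
    have e1 := Finset.map_union (f := Fin.castSuccEmb) I J
    have e2 := Finset.map_inter (f := Fin.castSuccEmb) I J
    have n1 := last_notMem_map I
    have n2 := last_notMem_map J
    have s1 := h.submodular (I.map Fin.castSuccEmb) (J.map Fin.castSuccEmb)
    have s2 := h.submodular (insert (Fin.last n) (I.map Fin.castSuccEmb)) (J.map Fin.castSuccEmb)
    have s3 := h.submodular (I.map Fin.castSuccEmb) (insert (Fin.last n) (J.map Fin.castSuccEmb))
    have s4 := h.submodular (insert (Fin.last n) (I.map Fin.castSuccEmb))
      (insert (Fin.last n) (J.map Fin.castSuccEmb))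
    rw [Finset.insert_union, Finset.insert_inter_of_notMem n2] at s2
    rw [Finset.union_insert, Finset.inter_insert_of_notMem n1] at s3
    rw [← Finset.insert_union_distrib, ← Finset.insert_inter_distrib] at s4
    simp only [sliceRank, e1, e2]
    -- Whichever terms attain the two minima, one of `s1`–`s4` applies, and `t` is subtracted
    -- equally often on both sides.
    rcases min_cases (f (I.map Fin.castSuccEmb))
        (f (insert (Fin.last n) (I.map Fin.castSuccEmb)) - t) with ⟨c1, _⟩ | ⟨c1, _⟩ <;>
      rcases min_cases (f (J.map Fin.castSuccEmb))
        (f (insert (Fin.last n) (J.map Fin.castSuccEmb)) - t) with ⟨c2, _⟩ | ⟨c2, _⟩ <;>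
      rw [c1, c2] <;>
      have m1 := min_le_left (f (I.map Fin.castSuccEmb ∪ J.map Fin.castSuccEmb))
        (f (insert (Fin.last n) (I.map Fin.castSuccEmb ∪ J.map Fin.castSuccEmb)) - t) <;>
      have m2 := min_le_right (f (I.map Fin.castSuccEmb ∪ J.map Fin.castSuccEmb))
        (f (insert (Fin.last n) (I.map Fin.castSuccEmb ∪ J.map Fin.castSuccEmb)) - t) <;>
      have m3 := min_le_left (f (I.map Fin.castSuccEmb ∩ J.map Fin.castSuccEmb))
        (f (insert (Fin.last n) (I.map Fin.castSuccEmb ∩ J.map Fin.castSuccEmb)) - t) <;>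
      have m4 := min_le_right (f (I.map Fin.castSuccEmb ∩ J.map Fin.castSuccEmb))
        (f (insert (Fin.last n) (I.map Fin.castSuccEmb ∩ J.map Fin.castSuccEmb)) - t) <;>
      linarith
  mem_iff b := by
    have hu : sliceRank f t Finset.univ = f Finset.univ - t := by
      rw [sliceRank, insert_last_map_univ, map_castSucc_univ, min_eq_right]
      unfold lastMin at h1
      linarith
    rw [hu, Polymatroid.slice, Set.mem_ofPred_eq, h.mem_iff, Fin.sum_univ_castSucc]
    simp only [Fin.snoc_castSucc, Fin.snoc_last, sliceRank, le_min_iff]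
    refine and_congr ⟨fun hI I => ⟨?_, ?_⟩, fun hI I => ?_⟩ eq_sub_iff_add_eq.symm
    · simpa using hI (I.map Fin.castSuccEmb)
    · have := hI (insert (Fin.last n) (I.map Fin.castSuccEmb))
      rw [sum_insert_snoc] at this
      linarith
    · obtain ⟨J, rfl | rfl⟩ := exists_eq_map_castSucc I
      · simpa using (hI J).1
      · rw [sum_insert_snoc]
        linarith [(hI J).2]

theorem internallyActive_snoc (P : Set (Fin (n + 1) → ℤ)) (b : Fin n → ℤ) (t : ℤ) (i : Fin n) :
    InternallyActive P (Fin.snoc b t) i.castSucc ↔ InternallyActive (slice P t) b i := by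
  have e : ∀ j : Fin n, (Fin.snoc b t : Fin (n + 1) → ℤ) - Pi.single i.castSucc 1 +
      Pi.single j.castSucc 1 = Fin.snoc (b - Pi.single i 1 + Pi.single j 1) t := by
    intro j
    ext k
    induction k using Fin.lastCases <;>
      simp [Pi.single_apply, (Fin.castSucc_ne_last _).symm]
  refine ⟨fun h j hj hm => h j.castSucc (by simpa using hj) ?_, fun h j hj => ?_⟩
  · rw [e]
    exact hm
  · induction j using Fin.lastCases with
    | last => exact absurd (Fin.castSucc_lt_last i) hj.asymm
    | cast j =>
      rw [e]
      exact h j (by simpa using hj)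

theorem externallyActive_snoc (P : Set (Fin (n + 1) → ℤ)) (b : Fin n → ℤ) (t : ℤ) (i : Fin n) :
    ExternallyActive P (Fin.snoc b t) i.castSucc ↔ ExternallyActive (slice P t) b i := by
  have e : ∀ j : Fin n, (Fin.snoc b t : Fin (n + 1) → ℤ) + Pi.single i.castSucc 1 -
      Pi.single j.castSucc 1 = Fin.snoc (b + Pi.single i 1 - Pi.single j 1) t := by
    intro j
    ext k
    induction k using Fin.lastCases <;>
      simp [Pi.single_apply, (Fin.castSucc_ne_last _).symm]
  refine ⟨fun h j hj hm => h j.castSucc (by simpa using hj) ?_, fun h j hj => ?_⟩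
  · rw [e]
    exact hm
  · induction j using Fin.lastCases with
    | last => exact absurd (Fin.castSucc_lt_last i) hj.asymm
    | cast j =>
      rw [e]
      exact h j (by simpa using hj)

end LastIndex

/-! ### Recursion over slices -/

section Recursion

open Classical in
/-- The contribution of an index, given whether it is internally and externally active. -/
noncomputable def activityFactor (p q : Prop) : MvPolynomial (Fin 2) ℤ :=
  if p then (if q then X 0 + X 1 - 1 else X 0) else if q then X 1 else 1

/-- In product form the factor of the last index splits off. -/
theorem weight_eq_prod {n : ℕ} (P : Set (Fin n → ℤ)) (a : Fin n → ℤ) :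
    (X 0 ^ (intSet P a \ extSet P a).card * X 1 ^ (extSet P a \ intSet P a).card *
      (X 0 + X 1 - 1) ^ (intSet P a ∩ extSet P a).card : MvPolynomial (Fin 2) ℤ) =
    ∏ i, activityFactor (InternallyActive P a i) (ExternallyActive P a i) := by
  classical
  have hpow : ∀ (s : Finset (Fin n)) (c : MvPolynomial (Fin 2) ℤ),
      c ^ s.card = ∏ i, if i ∈ s then c else 1 := by
    intro s c
    rw [Finset.prod_ite_mem, Finset.univ_inter, Finset.prod_const]
  rw [hpow, hpow, hpow, ← Finset.prod_mul_distrib, ← Finset.prod_mul_distrib]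
  refine Finset.prod_congr rfl fun i _ => ?_
  by_cases hi : InternallyActive P a i <;> by_cases he : ExternallyActive P a i <;>
    simp [activityFactor, intSet, extSet, hi, he]

theorem tutte_eq {n : ℕ} (P : Set (Fin n → ℤ)) : tutte P =
    ∑ᶠ a ∈ P, ∏ i, activityFactor (InternallyActive P a i) (ExternallyActive P a i) := by
  simp only [tutte, weight_eq_prod]

variable {n : ℕ} {P : Set (Fin (n + 1) → ℤ)} {f : Finset (Fin (n + 1)) → ℤ}

theorem IsPolymatroid.tutte_eq_sum_slice (h : IsPolymatroid P f) :
    tutte P = ∑ t ∈ Finset.Icc (lastMin f) (f {Fin.last n}),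
      activityFactor (t = lastMin f) (t = f {Fin.last n}) * tutte (Polymatroid.slice P t) := by
  have hfin : ∀ t ∈ Finset.Icc (lastMin f) (f {Fin.last n}), (Polymatroid.slice P t).Finite :=
    fun t ht => (h.slice (Finset.mem_Icc.1 ht).1 (Finset.mem_Icc.1 ht).2).finite
  have hU : P = ⋃ t ∈ (↑(Finset.Icc (lastMin f) (f {Fin.last n})) : Set ℤ),
      (fun b : Fin n → ℤ => (Fin.snoc b t : Fin (n + 1) → ℤ)) '' Polymatroid.slice P t := by
    ext a
    simp only [Set.mem_iUnion, Finset.mem_coe, Finset.mem_Icc, Set.mem_image]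
    constructor
    · intro ha
      exact ⟨a (Fin.last n), ⟨h.lastMin_le ha, h.le_lastMax ha⟩, Fin.init a,
        by simpa [Polymatroid.slice] using ha, by simp⟩
    · rintro ⟨t, -, b, hb, rfl⟩
      exact hb
  rw [tutte_eq]
  conv_lhs => rw [finsum_mem_congr hU (fun _ _ => rfl)]
  have hdisj : Set.PairwiseDisjoint (↑(Finset.Icc (lastMin f) (f {Fin.last n})))
      fun t => (fun b : Fin n → ℤ => (Fin.snoc b t : Fin (n + 1) → ℤ)) '' Polymatroid.slice P t := by
    intro s _ t _ hst
    refine Set.disjoint_left.2 ?_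
    rintro _ ⟨b, _, rfl⟩ ⟨c, _, hc⟩
    have := congrFun hc (Fin.last n)
    simp at this
    exact hst this.symm
  rw [finsum_mem_biUnion (I := ↑(Finset.Icc (lastMin f) (f {Fin.last n}))) hdisj
    (Finset.finite_toSet _) (fun t ht => (hfin t ht).image _), finsum_mem_coe_finset]
  refine Finset.sum_congr rfl fun t ht => ?_
  have hinj : Function.Injective
      (fun b : Fin n → ℤ => (Fin.snoc b t : Fin (n + 1) → ℤ)) := fun b c hbc => by
    ext i
    simpa using congrFun hbc i.castSucc
  rw [finsum_mem_image hinj.injOn, tutte_eq, finsum_mem_eq_finite_toFinset_sum _ (hfin t ht),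
    finsum_mem_eq_finite_toFinset_sum _ (hfin t ht), Finset.mul_sum]
  refine Finset.sum_congr rfl fun b hb => ?_
  rw [Set.Finite.mem_toFinset] at hb
  rw [Fin.prod_univ_castSucc, mul_comm]
  simp only [internallyActive_snoc, externallyActive_snoc, h.internallyActive_last_iff hb,
    h.externallyActive_last_iff hb, Fin.snoc_last]

end Recursion

/-! ### The three leading coefficients in `x` -/

section Coefficients

theorem coeffXY_add (p q : MvPolynomial (Fin 2) ℤ) (k l : ℤ) :
    coeffXY (p + q) k l = coeffXY p k l + coeffXY q k l := by
  unfold coeffXY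
  split_ifs <;> simp

theorem coeffXY_sub (p q : MvPolynomial (Fin 2) ℤ) (k l : ℤ) :
    coeffXY (p - q) k l = coeffXY p k l - coeffXY q k l := by
  unfold coeffXY
  split_ifs <;> simp

theorem coeffXY_sum {ι : Type*} (s : Finset ι) (p : ι → MvPolynomial (Fin 2) ℤ) (k l : ℤ) :
    coeffXY (∑ i ∈ s, p i) k l = ∑ i ∈ s, coeffXY (p i) k l := by
  unfold coeffXY
  split_ifs <;> simp [coeff_sum]

theorem coeffXY_X_zero_mul (p : MvPolynomial (Fin 2) ℤ) (k l : ℤ) :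
    coeffXY (X 0 * p) k l = coeffXY p (k - 1) l := by
  unfold coeffXY
  by_cases hl : 0 ≤ l
  · by_cases hk : 0 ≤ k - 1
    · rw [if_pos ⟨by omega, hl⟩, if_pos ⟨hk, hl⟩, show k.toNat = 1 + (k - 1).toNat by omega,
        Finsupp.single_add, add_assoc, coeff_X_mul]
    · rw [if_neg (fun h : 0 ≤ k - 1 ∧ 0 ≤ l => hk h.1)]
      split_ifs with h
      · rw [coeff_X_mul', if_neg]
        have : k = 0 := by omega
        simp [this]
      · rfl
  · rw [if_neg (fun h => hl h.2), if_neg (fun h => hl h.2)]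

theorem coeffXY_X_one_mul (p : MvPolynomial (Fin 2) ℤ) (k : ℤ) :
    coeffXY (X 1 * p) k 0 = 0 := by
  unfold coeffXY
  split_ifs with h
  · rw [coeff_X_mul', if_neg]
    simp
  · rfl

variable {n : ℕ} {P : Set (Fin (n + 1) → ℤ)} {f : Finset (Fin (n + 1)) → ℤ}

theorem sum_Ico_sub_telescope (H : ℤ → ℤ) {a b : ℤ} (hab : a ≤ b) :
    ∑ t ∈ Finset.Ico a b, (H (t + 1) - H t) = H b - H a := by
  induction b, hab using Int.leInduction with
  | base => simp
  | succ b hb ih =>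
    rw [← Finset.insert_Ico_right_eq_Ico_add_one hb, Finset.sum_insert (by simp), ih]
    ring

/-- The recursion for the coefficients of `x ^ k`, in terms of a discrete antiderivative of the
coefficients of the slices. -/
theorem IsPolymatroid.coeffXY_tutte_succ (h : IsPolymatroid P f) (k : ℤ) (H : ℤ → ℤ)
    (hH : ∀ t, lastMin f ≤ t → t ≤ f {Fin.last n} →
      coeffXY (tutte (Polymatroid.slice P t)) k 0 = H (t + 1) - H t) :
    coeffXY (tutte P) k 0 = coeffXY (tutte (Polymatroid.slice P (lastMin f))) (k - 1) 0 +
      (H (f {Fin.last n}) - H (lastMin f + 1)) := by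
  rw [h.tutte_eq_sum_slice, coeffXY_sum]
  obtain heq | hlt := h.lastMin_le_lastMax.eq_or_lt
  -- With a single slice the factor is `x + y - 1`; its `-1` contributes `H t - H (t + 1)`, so the
  -- telescoped formula persists.
  · rw [← heq, Finset.Icc_self, Finset.sum_singleton]
    simp only [activityFactor, if_true, add_mul, sub_mul, one_mul, coeffXY_add, coeffXY_sub,
      coeffXY_X_zero_mul, coeffXY_X_one_mul, hH _ le_rfl heq.le]
    ring
  · rw [← Finset.Ico_insert_right hlt.le, Finset.sum_insert (by simp),
      ← Finset.insert_Ico_add_one_left_eq_Ico hlt, Finset.sum_insert (by simp),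
      ← sum_Ico_sub_telescope H (a := lastMin f + 1) (b := f {Fin.last n}) (by omega)]
    simp only [activityFactor, hlt.ne, hlt.ne', if_true, if_false, coeffXY_X_zero_mul,
      coeffXY_X_one_mul, zero_add]
    congr 1
    refine Finset.sum_congr rfl fun t ht => ?_
    rw [Finset.mem_Ico] at ht
    rw [if_neg (by omega), if_neg (by omega), one_mul, hH t (by omega) (by omega)]

/-- By submodularity no truncation occurs at the lowest level. -/
theorem IsPolymatroid.sliceRank_lastMin (h : IsPolymatroid P f) (I : Finset (Fin n)) :
    sliceRank f (lastMin f) I = f (I.map Fin.castSuccEmb) := by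
  refine min_eq_left ?_
  have := h.submodular (insert (Fin.last n) (I.map Fin.castSuccEmb)) {Fin.last n}ᶜ
  have e1 : insert (Fin.last n) (I.map Fin.castSuccEmb) ∪ {Fin.last n}ᶜ = Finset.univ := by
    ext i
    induction i using Fin.lastCases <;> simp [Fin.castSucc_ne_last]
  have e2 : insert (Fin.last n) (I.map Fin.castSuccEmb) ∩ {Fin.last n}ᶜ =
      I.map Fin.castSuccEmb := by
    ext i
    induction i using Fin.lastCases <;> simp [Fin.castSucc_ne_last]
  rw [e1, e2] at this
  unfold lastMin
  linarith

theorem sliceRank_univ {t : ℤ} (ht : lastMin f ≤ t) :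
    sliceRank f t Finset.univ = f Finset.univ - t := by
  rw [sliceRank, insert_last_map_univ, map_castSucc_univ, min_eq_right]
  unfold lastMin at ht
  linarith

theorem tutte_fin_zero {P : Set (Fin 0 → ℤ)} {f : Finset (Fin 0) → ℤ} (h : IsPolymatroid P f) :
    tutte P = 1 := by
  have : P = {0} := by
    ext a
    rw [h.mem_iff]
    simp [Subsingleton.elim a 0, h.rank_empty, Subsingleton.elim _ (∅ : Finset (Fin 0))]
  rw [tutte_eq, this]
  simp

theorem coeffXY_one (k : ℤ) : coeffXY 1 k 0 = if k = 0 then 1 else 0 := by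
  unfold coeffXY
  rcases lt_trichotomy k 0 with hk | rfl | hk
  · rw [if_neg (by omega), if_neg (by omega)]
  · simp
  · rw [if_pos (by omega), if_neg (by omega), coeff_one, if_neg]
    intro h0
    have := DFunLike.congr_fun h0 0
    simp at this
    omega

theorem IsPolymatroid.coeffXY_tutte_of_lt {n : ℕ} {P : Set (Fin n → ℤ)} {f : Finset (Fin n) → ℤ}
    (h : IsPolymatroid P f) {k : ℤ} (hk : (n : ℤ) < k) : coeffXY (tutte P) k 0 = 0 := by
  induction n generalizing k with
  | zero => rw [tutte_fin_zero h, coeffXY_one, if_neg (by simpa using hk.ne')]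
  | succ n ih =>
    push_cast at hk
    rw [h.coeffXY_tutte_succ k (fun _ => 0) fun t h1 h2 => by
        rw [ih (h.slice h1 h2) (by linarith), sub_zero],
      ih (h.slice le_rfl h.lastMin_le_lastMax) (by linarith)]
    simp

theorem IsPolymatroid.coeffXY_tutte_top {n : ℕ} {P : Set (Fin n → ℤ)} {f : Finset (Fin n) → ℤ}
    (h : IsPolymatroid P f) : coeffXY (tutte P) n 0 = 1 := by
  induction n with
  | zero => rw [tutte_fin_zero h, coeffXY_one, if_pos (by simp)]
  | succ n ih =>
    rw [h.coeffXY_tutte_succ _ (fun _ => 0) fun t h1 h2 => by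
        rw [(h.slice h1 h2).coeffXY_tutte_of_lt (by simp), sub_zero]]
    push_cast
    rw [add_sub_cancel_right, ih (h.slice le_rfl h.lastMin_le_lastMax)]
    simp

theorem IsPolymatroid.coeffXY_tutte_sub_one {n : ℕ} {P : Set (Fin n → ℤ)}
    {f : Finset (Fin n) → ℤ} (h : IsPolymatroid P f) :
    coeffXY (tutte P) ((n : ℤ) - 1) 0 = ∑ i, f {i} - f Finset.univ - n := by
  induction n with
  | zero =>
    rw [tutte_fin_zero h, coeffXY_one, if_neg (by simp)]
    simp [h.rank_empty]
  | succ n ih =>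
    push_cast
    rw [add_sub_cancel_right, h.coeffXY_tutte_succ _ (fun t => t) fun t h1 h2 => by
        rw [(h.slice h1 h2).coeffXY_tutte_top, add_sub_cancel_left],
      ih (h.slice le_rfl h.lastMin_le_lastMax), sliceRank_univ le_rfl, Fin.sum_univ_castSucc]
    simp only [h.sliceRank_lastMin, Finset.map_singleton, Fin.castSuccEmb_apply]
    ring

theorem choose_two_add_one (x : ℤ) : Ring.choose (x + 1) 2 = Ring.choose x 2 + x := by
  rw [Ring.choose_succ_succ, Ring.choose_one_right, add_comm]

/-- A discrete antiderivative of the truncation `max 0 x`. -/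
theorem choose_two_max_add_one (x : ℤ) :
    Ring.choose (max 0 (x + 1)) 2 = Ring.choose (max 0 x) 2 + max 0 x := by
  rcases le_or_gt 0 x with hx | hx
  · rw [max_eq_right (by omega), max_eq_right hx, choose_two_add_one]
  · rw [max_eq_left (by omega), max_eq_left hx.le, add_zero]

theorem choose_two_max_of_le_one {x : ℤ} (hx : x ≤ 1) : Ring.choose (max 0 x) 2 = 0 := by
  have h0 : Ring.choose (0 : ℤ) 2 = 0 := Ring.choose_zero_pos ℤ two_pos
  rcases le_or_gt x 0 with h | h
  · rw [max_eq_left h, h0]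
  · obtain rfl : x = 0 + 1 := by omega
    rw [max_eq_right (by norm_num), choose_two_add_one, h0, add_zero]

theorem sum_pairs_castSucc (g : Fin (n + 1) → Fin (n + 1) → ℤ) :
    ∑ p : Fin (n + 1) × Fin (n + 1) with p.1 < p.2, g p.1 p.2 =
      ∑ p : Fin n × Fin n with p.1 < p.2, g p.1.castSucc p.2.castSucc +
        ∑ i : Fin n, g i.castSucc (Fin.last n) := by
  simp only [Finset.sum_filter, Fintype.sum_prod_type, Fin.sum_univ_castSucc,
    Fin.castSucc_lt_castSucc_iff, Fin.castSucc_lt_last, lt_self_iff_false,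
    (Fin.castSucc_lt_last _).not_gt, if_true, if_false, Finset.sum_const_zero, add_zero,
    Finset.sum_add_distrib]

theorem IsPolymatroid.coeffXY_tutte_sub_two {n : ℕ} {P : Set (Fin n → ℤ)}
    {f : Finset (Fin n) → ℤ} (h : IsPolymatroid P f) :
    coeffXY (tutte P) ((n : ℤ) - 2) 0 =
      Ring.choose ((∑ i, f {i}) - f Finset.univ + 1 - (n : ℤ)) 2 -
        ∑ p : Fin n × Fin n with p.1 < p.2, Ring.choose (f {p.1} + f {p.2} - f {p.1, p.2}) 2 := by
  induction n with
  | zero =>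
    rw [tutte_fin_zero h, coeffXY_one, if_neg (by simp), show f Finset.univ = 0 from h.rank_empty]
    have := choose_two_add_one 0
    simp_all [Ring.choose_zero_pos ℤ two_pos]
  | succ n ih =>
    set G : ℤ := ∑ i : Fin n, f {i.castSucc} - f Finset.univ - n with hG
    set m : Fin n → ℤ := fun i => f {i.castSucc, Fin.last n} - f {i.castSucc} with hm
    -- The slice at `t` has coefficient `G + t - ∑ i, max 0 (t - m i)`, `m i` being the level above
    -- which `{i}` is truncated; this is its antiderivative.
    rw [h.coeffXY_tutte_succ _
      (fun t => Ring.choose (G + t) 2 - ∑ i, Ring.choose (max 0 (t - m i)) 2) ?_]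
    · have hk : ((n + 1 : ℕ) : ℤ) - 2 - 1 = (n : ℤ) - 2 := by push_cast; ring
      -- Since `m i ≥ lastMin f`, the argument is at most `1`.
      have hmin : ∀ i, Ring.choose (max 0 (lastMin f + 1 - m i)) 2 = 0 := fun i => by
        refine choose_two_max_of_le_one ?_
        have := h.sliceRank_lastMin {i}
        have h2 : sliceRank f (lastMin f) {i} ≤ _ := min_le_right _ _
        rw [this, Finset.map_singleton, Finset.pair_comm] at h2
        simp only [Fin.castSuccEmb_apply] at h2
        simp only [hm]
        linarith
      -- Submodularity on `{i}` and `{last}` makes the difference nonnegative: the pair terms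
      -- appear.
      have hmax : ∀ i, max 0 (f {Fin.last n} - m i) =
          f {i.castSucc} + f {Fin.last n} - f {i.castSucc, Fin.last n} := fun i => by
        have := h.submodular {i.castSucc} {Fin.last n}
        rw [Finset.singleton_inter_of_notMem (by simp [Fin.castSucc_ne_last]), h.rank_empty,
          ← Finset.insert_eq] at this
        rw [max_eq_right] <;> simp only [hm] <;> linarith
      rw [hk, ih (h.slice le_rfl h.lastMin_le_lastMax), sliceRank_univ le_rfl,
        sum_pairs_castSucc fun i j => Ring.choose (f {i} + f {j} - f {i, j}) 2]
      simp only [h.sliceRank_lastMin, Finset.map_singleton, Finset.map_insert,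
        Fin.castSuccEmb_apply, hmin, hmax, Fin.sum_univ_castSucc, Finset.sum_const_zero, sub_zero]
      rw [show ∑ i : Fin n, f {i.castSucc} - (f Finset.univ - lastMin f) + 1 - (n : ℤ) =
          G + (lastMin f + 1) by rw [hG]; ring,
        show ∑ i : Fin n, f {i.castSucc} + f {Fin.last n} - f Finset.univ + 1 -
          ((n + 1 : ℕ) : ℤ) = G + f {Fin.last n} by rw [hG]; push_cast; ring]
      ring
    · intro t h1 h2
      have hk : ((n + 1 : ℕ) : ℤ) - 2 = (n : ℤ) - 1 := by push_cast; ring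
      have hr : ∀ i, sliceRank f t {i} = f {i.castSucc} - max 0 (t - m i) := fun i => by
        rw [sliceRank, Finset.map_singleton, Finset.pair_comm, Fin.castSuccEmb_apply]
        simp only [hm]
        rcases le_total 0 (t - (f {i.castSucc, Fin.last n} - f {i.castSucc})) with hc | hc
        · rw [max_eq_right hc, min_eq_right] <;> linarith
        · rw [max_eq_left hc, min_eq_left] <;> linarith
      have hs : ∀ i, t + 1 - m i = t - m i + 1 := fun i => by ring
      rw [hk, (h.slice h1 h2).coeffXY_tutte_sub_one, sliceRank_univ h1]
      simp only [hr, hs, choose_two_max_add_one, Finset.sum_add_distrib, Finset.sum_sub_distrib]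
      rw [← add_assoc, choose_two_add_one, hG]
      ring

end Coefficients

end Polymatroid

theorem theorem5p4 {n : ℕ} (P : Set (Fin n → ℤ)) (f : Finset (Fin n) → ℤ)
    (hP : Polymatroid.IsPolymatroid P f) :
    Polymatroid.coeffXY (Polymatroid.tutte P) ((n : ℤ) - 2) 0 =
        Ring.choose ((∑ i : Fin n, f {i}) - f Finset.univ + 1 - (n : ℤ)) 2 -
          ∑ p : Fin n × Fin n with p.1 < p.2,
            Ring.choose (f {p.1} + f {p.2} - f {p.1, p.2}) 2 ∧
      Polymatroid.coeffXY (Polymatroid.tutte P) 0 ((n : ℤ) - 2) =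
        Ring.choose
            ((∑ i : Fin n, f {i}ᶜ) - ((n : ℤ) - 1) * f Finset.univ + 1 - (n : ℤ)) 2 -
          ∑ p : Fin n × Fin n with p.1 < p.2,
            Ring.choose (f {p.1}ᶜ + f {p.2}ᶜ - f {p.1, p.2}ᶜ - f Finset.univ) 2 := by
  refine ⟨hP.coeffXY_tutte_sub_two, ?_⟩
  rw [← Polymatroid.coeffXY_rename_swap, ← hP.tutte_neg, hP.neg.coeffXY_tutte_sub_two]
  simp only [Polymatroid.dualRank, Finset.compl_univ, hP.rank_empty, Finset.sum_sub_distrib,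
    Finset.sum_const, Finset.card_univ, Fintype.card_fin, nsmul_eq_mul]
  congr 2
  · ring
  · ext p
    congr 1
    ring
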